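/- Let $\mathcal{A}$ be a complex Banach algebra with identity $1$. For $a\in\mathcal{A}$ let $\{a\}'=\{c\in\mathcal{A}: ac=ca\}$, and let $\{a\}''$ be the set of elements of $\mathcal{A}$ commuting with every element of $\{a\}'$. Call $a$ quasinilpotent if $\sigma(a)=\{0\}$. Call $y$ a generalized Drazin inverse of $a$ if $y\in\{a\}'$, $yay=y$ and $a-a^{2}y$ is quasinilpotent; such a $y$ is unique if it exists and is denoted by $a^{d}$. Let $\mathcal{A}^{d}$ be the set of all elements having a generalized Drazin inverse, and let $\mathcal{A}^{acc}=\{a\in\mathcal{A}: a-\lambda 1\in\mathcal{A}^{d}\text{ for all }\lambda\in\mathbb{C}\setminus\{0\}\}$. Call $x$ an ag-Drazin inverse of $a$ if $x\in\{a\}'$, $xax=x$ and $a-a^{2}x\in\mathcal{A}^{acc}$, and let $\mathcal{A}^{ad}$ be the set of all elements having an ag-Drazin inverse. Let $a\in\mathcal{A}^{ad}$ and $b\in\mathcal{A}^{d}$ with $ab=ba=0$. Then $a+b\in\mathcal{A}^{ad}$. Moreover, $a$ has an ag-Drazin inverse belonging to $\{a\}''$, and for every ag-Drazin inverse $x$ of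 $a$ with $x\in\{a\}''$, the element $x+b^{d}$ is an ag-Drazin inverse of $a+b$. -/

import Mathlib

namespace AgDrazin

variable {A : Type*} [NormedRing A] [NormedAlgebra ℂ A]

/-- `a` is quasinilpotent: its spectrum is `{0}`. -/
def IsQuasinilpotent (a : A) : Prop :=
  spectrum ℂ a = {0}

/-- `x` is a generalized Drazin inverse of `a`: `x ∈ {a}'`, `x a x = x` and `a - a² x` is
quasinilpotent. -/
def IsGDrazinInverse (a x : A) : Prop :=
  x ∈ Set.centralizer ({a} : Set A) ∧ x * a * x = x ∧ IsQuasinilpotent (a - a ^ 2 * x)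

/-- `a` is generalized Drazin invertible. -/
def IsGDrazinInvertible (a : A) : Prop :=
  ∃ x : A, IsGDrazinInverse a x

/-- `a` belongs to the class `A^acc`: `a - λ 1` is generalized Drazin invertible for every
complex `λ ≠ 0`. -/
def IsAcc (a : A) : Prop :=
  ∀ z : ℂ, z ≠ 0 → IsGDrazinInvertible (a - algebraMap ℂ A z)

/-- `x` is an ag-Drazin inverse of `a`: `x ∈ {a}'`, `x a x = x` and `a - a² x` is in `A^acc`. -/
def IsAgDrazinInverse (a x : A) : Prop :=
  x ∈ Set.centralizer ({a} : Set A) ∧ x * a * x = x ∧ IsAcc (a - a ^ 2 * x)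

/-- `a` is ag-Drazin invertible. -/
def IsAgDrazinInvertible (a : A) : Prop :=
  ∃ x : A, IsAgDrazinInverse a x

end AgDrazin

/-! Sum: `ab = ba = 0` makes `x` annihilate `b` and `y` annihilate `a`, so the remainder of `a + b`
is `α + β` with `α = a - a²x`, `β = b - b²y`, `αβ = βα = 0`. For `z ≠ 0`, `(α - z)(β - z) = -z(α + β
- z)` and `β - z` is a unit, so `α + β - z` is `α - z` times a commuting unit, which preserves
generalized Drazin invertibility.

Double commutant: let `c` commute with `a`. The off-diagonal block `w = (1 - ax)c(ax)` satisfies `w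
= αwx = αⁿwxⁿ`, and likewise for the other block. Both vanish once `r(α) r(x) < 1`, and then `x`
commutes with `c`. To reach this inequality, bound `σ(x)` by `M`. The spectrum of `α` accumulates at
most at `0`, so only finitely many of its points have modulus at least `1/M`. Their spectral
idempotents are moved to the regular part, which adds to `σ(x)` only points `1/l` of modulus at most
`M`. -/

open Filter Topology

namespace AgDrazin

section Algebraic

variable {R : Type*} [Ring R]

/-- If `e` is an idempotent commuting with the units `u` and `v`, then `u e + v (1 - e)` is a
unit. -/
theorem isUnit_mul_add_mul_one_sub {e u v : R} (he : e * e = e) (hu : IsUnit u) (hv : IsUnit v)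
    (hue : u * e = e * u) (hve : v * e = e * v) : IsUnit (u * e + v * (1 - e)) := by
  obtain ⟨u, rfl⟩ := hu
  obtain ⟨v, rfl⟩ := hv
  have hue' : (↑u⁻¹ : R) * e = e * ↑u⁻¹ :=
    (Commute.units_inv_left (show Commute (u : R) e from hue)).eq
  have hve' : (↑v⁻¹ : R) * e = e * ↑v⁻¹ :=
    (Commute.units_inv_left (show Commute (v : R) e from hve)).eq
  have hu1 := u.mul_inv
  have hu2 := u.inv_mul
  have hv1 := v.mul_inv
  have hv2 := v.inv_mul
  generalize (u : R) = a at *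
  generalize (↑u⁻¹ : R) = a' at *
  generalize (v : R) = b at *
  generalize (↑v⁻¹ : R) = b' at *
  refine ⟨⟨a * e + b * (1 - e), a' * e + b' * (1 - e), ?_, ?_⟩, rfl⟩
  · have h1 : e * (1 - e) = 0 := by rw [mul_sub, he, mul_one, sub_self]
    have h2 : (1 - e) * e = 0 := by rw [sub_mul, he, one_mul, sub_self]
    have h3 : (1 - e) * (1 - e) = 1 - e := by rw [mul_sub, h2, mul_one, sub_zero]
    have hb' : b' * (1 - e) = (1 - e) * b' := by rw [mul_sub, sub_mul, hve', mul_one, one_mul]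
    calc _ = a * (e * e) * a' + a * (e * (1 - e)) * b' + b * ((1 - e) * e) * a'
          + b * ((1 - e) * (1 - e)) * b' := by
          rw [hue', hb']; noncomm_ring
      _ = a * a' * e + b * b' * (1 - e) := by
          rw [h1, h2, h3, he, mul_assoc a, ← hue', mul_assoc b (1 - e), ← hb']; noncomm_ring
      _ = 1 := by rw [hu1, hv1]; noncomm_ring
  · have h1 : e * (1 - e) = 0 := by rw [mul_sub, he, mul_one, sub_self]
    have h2 : (1 - e) * e = 0 := by rw [sub_mul, he, one_mul, sub_self]
    have h3 : (1 - e) * (1 - e) = 1 - e := by rw [mul_sub, h2, mul_one, sub_zero]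
    have hb' : b * (1 - e) = (1 - e) * b := by rw [mul_sub, sub_mul, hve, mul_one, one_mul]
    calc _ = a' * (e * e) * a + a' * (e * (1 - e)) * b + b' * ((1 - e) * e) * a
          + b' * ((1 - e) * (1 - e)) * b := by
          rw [hue, hb']; noncomm_ring
      _ = a' * a * e + b' * b * (1 - e) := by
          rw [h1, h2, h3, he, mul_assoc a', ← hue, mul_assoc b' (1 - e), ← hb']; noncomm_ring
      _ = 1 := by rw [hu2, hv2]; noncomm_ring

theorem mem_centralizer_singleton_of_comm {a x : R} (h : a * x = x * a) :
    x ∈ Set.centralizer ({a} : Set R) := by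
  rintro _ rfl
  exact h

theorem one_sub_mul_self_of_outer_inverse {u y : R} (h : y * u * y = y) :
    (1 - u * y) * (1 - u * y) = 1 - u * y := by
  linear_combination (norm := noncomm_ring) u * h

end Algebraic

/-! ### Spectral radius, quasinilpotents and commutation -/

variable {A : Type*} [NormedRing A] [NormedAlgebra ℂ A]

theorem algebraMap_isUnit {z : ℂ} (hz : z ≠ 0) : IsUnit (algebraMap ℂ A z) :=
  (isUnit_iff_ne_zero.mpr hz).map (algebraMap ℂ A)

theorem IsQuasinilpotent.spectralRadius_eq_zero {a : A} (h : IsQuasinilpotent a) :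
    spectralRadius ℂ a = 0 := by
  have h' : spectrum ℂ a = {0} := h
  simp [spectralRadius, h']

theorem IsGDrazinInverse.mul_comm {a y : A} (h : IsGDrazinInverse a y) : a * y = y * a :=
  h.1 a rfl

/-- In the zero ring every spectrum is empty, hence never `{0}`. -/
theorem IsGDrazinInverse.nontrivial {a y : A} (h : IsGDrazinInverse a y) : Nontrivial A := by
  by_contra hn
  rw [not_nontrivial_iff_subsingleton] at hn
  have h0 : spectrum ℂ (a - a ^ 2 * y) = {0} := h.2.2
  have : (0 : ℂ) ∈ spectrum ℂ (a - a ^ 2 * y) := by rw [h0]; rfl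
  exact spectrum.mem_iff.mp this (isUnit_of_subsingleton _)

variable [CompleteSpace A]

theorem isQuasinilpotent_iff [Nontrivial A] {n : A} :
    IsQuasinilpotent n ↔ ∀ z : ℂ, z ≠ 0 → IsUnit (n - algebraMap ℂ A z) := by
  constructor
  · intro h z hz
    rw [IsUnit.sub_iff]
    by_contra hc
    have : z ∈ spectrum ℂ n := spectrum.mem_iff.mpr hc
    rw [h] at this
    exact hz this
  · intro h
    refine (spectrum.nonempty n).subset_singleton_iff.mp fun z hz => ?_
    by_contra hc
    exact spectrum.mem_iff.mp hz ((IsUnit.sub_iff).mp (h z hc))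

theorem spectralRadius_ne_top [Nontrivial A] (a : A) : spectralRadius ℂ a ≠ ⊤ := by
  obtain ⟨z, -, hz⟩ := spectrum.exists_nnnorm_eq_spectralRadius a
  rw [← hz]
  exact ENNReal.coe_ne_top

theorem tendsto_pow_nnnorm_mul [Nontrivial A] (a b : A) :
    Tendsto (fun n : ℕ => ((‖a ^ n‖₊ * ‖b ^ n‖₊ : NNReal) : ENNReal) ^ (1 / n : ℝ)) atTop
      (𝓝 (spectralRadius ℂ a * spectralRadius ℂ b)) := by
  refine (ENNReal.Tendsto.mul (spectrum.pow_nnnorm_pow_one_div_tendsto_nhds_spectralRadius a)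
    (Or.inr (spectralRadius_ne_top b))
    (spectrum.pow_nnnorm_pow_one_div_tendsto_nhds_spectralRadius b)
    (Or.inr (spectralRadius_ne_top a))).congr fun n => ?_
  rw [ENNReal.coe_mul, ENNReal.mul_rpow_of_nonneg _ _ (by positivity)]

theorem spectralRadius_mul_le [Nontrivial A] {a b : A} (h : Commute a b) :
    spectralRadius ℂ (a * b) ≤ spectralRadius ℂ a * spectralRadius ℂ b := by
  refine le_of_tendsto_of_tendsto'
    (spectrum.pow_nnnorm_pow_one_div_tendsto_nhds_spectralRadius (a * b))
    (tendsto_pow_nnnorm_mul a b) fun n => ?_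
  refine ENNReal.rpow_le_rpow (ENNReal.coe_le_coe.mpr ?_) (by positivity)
  rw [h.mul_pow]
  exact nnnorm_mul_le _ _

theorem isQuasinilpotent_of_spectralRadius [Nontrivial A] {a : A} (h : spectralRadius ℂ a = 0) :
    IsQuasinilpotent a := by
  rw [isQuasinilpotent_iff]
  intro z hz
  rw [IsUnit.sub_iff]
  refine spectrum.mem_resolventSet_iff.mp (spectrum.mem_resolventSet_of_spectralRadius_lt ?_)
  rw [h]
  simpa using hz

theorem isQuasinilpotent_zero [Nontrivial A] : IsQuasinilpotent (0 : A) :=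
  isQuasinilpotent_of_spectralRadius spectrum.spectralRadius_zero

theorem IsQuasinilpotent.mul [Nontrivial A] {a b : A} (h : IsQuasinilpotent a)
    (hc : Commute a b) : IsQuasinilpotent (a * b) := by
  refine isQuasinilpotent_of_spectralRadius (le_antisymm ?_ bot_le)
  simpa [h.spectralRadius_eq_zero] using spectralRadius_mul_le hc

/-- An element `z` with `z = s z y` vanishes if the spectral radii of `s` and `y` have product
less than `1`. -/
theorem eq_zero_of_eq_mul_mul [Nontrivial A] {s y z : A}
    (hr : spectralRadius ℂ s * spectralRadius ℂ y < 1) (h : z = s * z * y) : z = 0 := by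
  have hn : ∀ n : ℕ, z = s ^ n * z * y ^ n := by
    intro n
    induction n with
    | zero => simp
    | succ n ih =>
      calc z = s ^ n * z * y ^ n := ih
        _ = s ^ n * (s * z * y) * y ^ n := by rw [← h]
        _ = s ^ (n + 1) * z * y ^ (n + 1) := by
          rw [pow_succ s, pow_succ' y]; simp only [mul_assoc]
  -- By Gelfand's formula `‖sⁿ‖‖yⁿ‖ ≤ ρⁿ` eventually, with `ρ < 1`.
  obtain ⟨ρ, hρ, hρ1⟩ := exists_between hr
  have hev : ∀ᶠ n : ℕ in atTop, (‖z‖₊ : ENNReal) ≤ ρ ^ n * ‖z‖₊ := by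
    filter_upwards [(tendsto_pow_nnnorm_mul s y).eventually_lt_const hρ, eventually_gt_atTop 0]
      with n hn1 hn0
    have h1 : ((‖s ^ n‖₊ * ‖y ^ n‖₊ : NNReal) : ENNReal) ≤ ρ ^ n := by
      have := ENNReal.rpow_le_rpow hn1.le (show (0 : ℝ) ≤ n by positivity)
      rwa [← ENNReal.rpow_mul, one_div, inv_mul_cancel₀ (by positivity), ENNReal.rpow_one,
        ENNReal.rpow_natCast] at this
    calc (‖z‖₊ : ENNReal) ≤ ((‖s ^ n‖₊ * ‖y ^ n‖₊ : NNReal) : ENNReal) * ‖z‖₊ := by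
          rw [← ENNReal.coe_mul, ENNReal.coe_le_coe]
          conv_lhs => rw [hn n]
          calc _ ≤ ‖s ^ n‖₊ * ‖z‖₊ * ‖y ^ n‖₊ :=
                (nnnorm_mul_le _ _).trans (mul_le_mul_left (nnnorm_mul_le _ _) _)
            _ = _ := by ring
      _ ≤ _ := by gcongr
  have hlim : Tendsto (fun n : ℕ => ρ ^ n * (‖z‖₊ : ENNReal)) atTop (𝓝 (0 * ‖z‖₊)) :=
    ENNReal.Tendsto.mul_const (ENNReal.tendsto_pow_atTop_nhds_zero_of_lt_one hρ1)
      (Or.inr ENNReal.coe_ne_top)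
  have := ge_of_tendsto hlim hev
  simpa using this

/-- A commuting outer inverse `y` of `a` commutes with everything that commutes with `a`, provided
that the spectral radii of `a - a² y` and `y` have product less than `1`. -/
theorem commute_of_spectralRadius_mul_lt_one [Nontrivial A] {a y c : A} (hay : a * y = y * a)
    (hy : y * a * y = y) (hr : spectralRadius ℂ (a - a ^ 2 * y) * spectralRadius ℂ y < 1)
    (hc : a * c = c * a) : y * c = c * y := by
  have hy' : a * y * y = y := by rw [hay, hy]
  -- `h1` and `h2` kill the off-diagonal blocks of `c` relative to the idempotent `ay`.
  have h1 : (1 - a * y) * c * (a * y) = 0 := by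
    refine eq_zero_of_eq_mul_mul hr ?_
    have e : (a - a ^ 2 * y) * (1 - a * y) = (1 - a * y) * a := by
      have e1 : a ^ 2 * y * (a * y) = a ^ 2 * y := by
        rw [← mul_assoc, mul_assoc (a ^ 2), mul_assoc (a ^ 2), hy]
      have e2 : a * y * a = a ^ 2 * y := by rw [mul_assoc, ← hay, pow_two, mul_assoc]
      linear_combination (norm := noncomm_ring) e1 + e2
    calc (1 - a * y) * c * (a * y) = (1 - a * y) * (a * c) * y := by rw [hc]; simp only [mul_assoc]
      _ = ((1 - a * y) * a) * c * (a * y * y) := by rw [hy']; simp only [mul_assoc]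
      _ = _ := by rw [← e]; simp only [mul_assoc]
  have h2 : (a * y) * c * (1 - a * y) = 0 := by
    rw [mul_comm] at hr
    refine eq_zero_of_eq_mul_mul hr ?_
    have e : (1 - a * y) * (a - a ^ 2 * y) = a * (1 - a * y) := by
      have e1 : a * y * (a ^ 2 * y) = a ^ 2 * y := by
        calc a * y * (a ^ 2 * y) = a * (y * a) * (a * y) := by rw [pow_two]; simp only [mul_assoc]
          _ = a * a * (y * (a * y)) := by rw [← hay]; simp only [mul_assoc]
          _ = _ := by rw [← mul_assoc y, hy, pow_two]
      have e2 : a * y * a = a ^ 2 * y := by rw [mul_assoc, ← hay, pow_two, mul_assoc]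
      linear_combination (norm := noncomm_ring) e1 - e2
    calc a * y * c * (1 - a * y) = y * (c * a) * (1 - a * y) := by
          rw [← hc, hay]; simp only [mul_assoc]
      _ = (y * a * y) * c * (a * (1 - a * y)) := by rw [hy]; simp only [mul_assoc]
      _ = _ := by rw [← e]; simp only [mul_assoc]
  have h3 : a * y * c = c * (a * y) := by
    linear_combination (norm := noncomm_ring) h2 - h1
  calc y * c = y * (a * y * c) := by simp only [← mul_assoc]; rw [hy]
    _ = y * (c * a) * y := by rw [h3]; simp only [mul_assoc]
    _ = (a * y * c) * y := by rw [← hc, hay]; simp only [mul_assoc]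
    _ = c * (a * y * y) := by rw [h3]; simp only [mul_assoc]
    _ = c * y := by rw [hy']

theorem IsGDrazinInverse.commute [Nontrivial A] {a y c : A} (h : IsGDrazinInverse a y)
    (hc : a * c = c * a) : y * c = c * y := by
  refine commute_of_spectralRadius_mul_lt_one h.mul_comm h.2.1 ?_ hc
  rw [h.2.2.spectralRadius_eq_zero]
  simp

end AgDrazin

/-! ### Stability of generalized Drazin invertibility and sums -/

namespace AgDrazin

variable {A : Type*} [NormedRing A] [NormedAlgebra ℂ A]

theorem IsAgDrazinInverse.mul_comm {a x : A} (h : IsAgDrazinInverse a x) : a * x = x * a :=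
  h.1 a rfl

theorem isUnit_add_sub_algebraMap {x y : A} {z : ℂ} (hxy : x * y = 0)
    (hx : IsUnit (x - algebraMap ℂ A z)) (hy : IsUnit (y - algebraMap ℂ A z)) :
    IsUnit (x + y - algebraMap ℂ A z) := by
  have h : (x - algebraMap ℂ A z) * (y - algebraMap ℂ A z)
      = -algebraMap ℂ A z * (x + y - algebraMap ℂ A z) := by
    have h1 := Algebra.commutes z x
    linear_combination (norm := noncomm_ring) hxy + h1
  have h2 := (hx.mul hy)
  rw [h] at h2
  have h3 : Commute (-algebraMap ℂ A z) (x + y - algebraMap ℂ A z) :=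
    (Algebra.commute_algebraMap_left z _).neg_left
  exact (h3.isUnit_mul_iff.mp h2).2

variable [CompleteSpace A] [Nontrivial A]

/-- Since `y` commutes with `v`, the witness `v⁻¹y` leaves the remainder `(u - u²y)v`, a
quasinilpotent times a commuting element. -/
theorem IsGDrazinInverse.mul_isUnit {u y v : A} (h : IsGDrazinInverse u y) (hv : IsUnit v)
    (huv : u * v = v * u) : IsGDrazinInvertible (u * v) := by
  have hy : Commute y v := h.commute huv
  have hu : Commute u v := huv
  have huy : Commute u y := h.mul_comm
  obtain ⟨v, rfl⟩ := hv
  have hy' : Commute y ↑v⁻¹ := hy.units_inv_right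
  have hu' : Commute u ↑v⁻¹ := hu.units_inv_right
  have hvv : Commute (v : A) ↑v⁻¹ := (Commute.refl (v : A)).units_inv_right
  have h1 : ↑v⁻¹ * y * (u * ↑v) = y * u := by
    rw [hu.eq, ← mul_assoc, ← hy'.eq, mul_assoc y, v.inv_mul, mul_one]
  refine ⟨↑v⁻¹ * y, mem_centralizer_singleton_of_comm ?_, ?_, ?_⟩
  · exact ((hu'.mul_left hvv).mul_right (huy.mul_left hy.symm)).eq
  · rw [h1, ← hy'.eq, ← mul_assoc, h.2.1]
  · have h2 : u * v - (u * v) ^ 2 * (↑v⁻¹ * y) = (u - u ^ 2 * y) * v := by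
      have h3 : (u * v) ^ 2 * (↑v⁻¹ * y) = u ^ 2 * y * v := by
        rw [hu.mul_pow, pow_two (v : A), mul_assoc (u ^ 2), mul_assoc (v : A), ← mul_assoc (v : A) _ y,
          v.mul_inv, one_mul, ← hy.eq, mul_assoc]
      rw [h3, sub_mul]
    rw [h2]
    exact h.2.2.mul (hu.sub_left ((hu.pow_left 2).mul_left hy))

/-- Everything is block diagonal for `e`; the scalar block is inverted by `c⁻¹` and leaves no
remainder. -/
theorem IsGDrazinInverse.corner {u z e : A} (h : IsGDrazinInverse u z) (he : e * e = e)
    (hue : u * e = e * u) {c : ℂ} (hc : c ≠ 0) :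
    IsGDrazinInvertible (u * e + c • (1 - e)) := by
  have hze : z * e = e * z := h.commute hue
  have h1 : e * (1 - e) = 0 := by rw [mul_sub, he, mul_one, sub_self]
  have h2 : (1 - e) * e = 0 := by rw [sub_mul, he, one_mul, sub_self]
  have h3 : (1 - e) * (1 - e) = 1 - e := by rw [mul_sub, h2, mul_one, sub_zero]
  have mulrule : ∀ (p q : A) (s t : ℂ), q * e = e * q →
      (p * e + s • (1 - e)) * (q * e + t • (1 - e)) = (p * q) * e + (s * t) • (1 - e) := by
    intro p q s t hq
    have hq' : q * (1 - e) = (1 - e) * q := by rw [mul_sub, sub_mul, hq, mul_one, one_mul]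
    have e1 : p * e * (q * e) = p * q * e := by rw [hq, mul_assoc p, ← mul_assoc e, he, ← hq, mul_assoc]
    have e2 : p * e * (t • (1 - e)) = 0 := by rw [mul_smul_comm, mul_assoc, h1, mul_zero, smul_zero]
    have e3 : s • (1 - e) * (q * e) = 0 := by
      rw [smul_mul_assoc, hq, ← mul_assoc, h2, zero_mul, smul_zero]
    have e4 : s • (1 - e) * (t • (1 - e)) = (s * t) • (1 - e) := by
      rw [smul_mul_smul_comm, h3]
    rw [add_mul, mul_add, mul_add, e1, e2, e3, e4, add_zero, zero_add]
  refine ⟨z * e + c⁻¹ • (1 - e), mem_centralizer_singleton_of_comm ?_, ?_, ?_⟩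
  · rw [mulrule _ _ _ _ hze, mulrule _ _ _ _ hue, h.mul_comm, _root_.mul_comm c]
  · rw [mulrule _ _ _ _ hue, mulrule _ _ _ _ hze, h.2.1, inv_mul_cancel₀ hc, one_mul]
  · have h4 : u * e + c • (1 - e) - (u * e + c • (1 - e)) ^ 2 * (z * e + c⁻¹ • (1 - e))
        = (u - u ^ 2 * z) * e := by
      rw [pow_two, mulrule _ _ _ _ hue, mulrule _ _ _ _ hze, mul_assoc c, mul_inv_cancel₀ hc,
        mul_one, pow_two, sub_mul]
      abel
    rw [h4]
    have hue' : Commute u e := hue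
    exact h.2.2.mul (hue'.sub_left ((hue'.pow_left 2).mul_left hze))

theorem IsAcc.add {α β : A} (hα : IsAcc α) (hβ : IsQuasinilpotent β) (h1 : α * β = 0)
    (h2 : β * α = 0) : IsAcc (α + β) := by
  intro z hz
  obtain ⟨y, hy⟩ := hα z hz
  have hb := isQuasinilpotent_iff.mp hβ z hz
  have ha := Algebra.commutes z α
  have hb' := Algebra.commutes z β
  have hv : IsUnit (algebraMap ℂ A (-z⁻¹) * (β - algebraMap ℂ A z)) :=
    (algebraMap_isUnit (by simpa using hz)).mul hb
  have key : (α - algebraMap ℂ A z) * (algebraMap ℂ A (-z⁻¹) * (β - algebraMap ℂ A z))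
      = α + β - algebraMap ℂ A z := by
    have h3 : algebraMap ℂ A (-z⁻¹) * algebraMap ℂ A z = -1 := by
      rw [← map_mul]; simp [hz]
    have h4 : (α - algebraMap ℂ A z) * (β - algebraMap ℂ A z)
        = -(algebraMap ℂ A z * (α + β - algebraMap ℂ A z)) := by
      linear_combination (norm := noncomm_ring) h1 + ha
    rw [← mul_assoc, ← Algebra.commutes, mul_assoc, h4, mul_neg, ← mul_assoc, h3]
    simp
  have := hy.mul_isUnit hv ?_
  · rwa [key] at this
  · rw [← mul_assoc, ← Algebra.commutes, mul_assoc, mul_assoc]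
    congr 1
    linear_combination (norm := noncomm_ring) h1 - h2 + ha - hb'

/-- The sum of an ag-Drazin inverse of `a` and of the generalized Drazin inverse of `b` is an
ag-Drazin inverse of `a + b` if `a` and `b` annihilate each other. -/
theorem IsAgDrazinInverse.add {a b x y : A} (hx : IsAgDrazinInverse a x)
    (hy : IsGDrazinInverse b y) (hab : a * b = 0) (hba : b * a = 0) :
    IsAgDrazinInverse (a + b) (x + y) := by
  have ha := hx.mul_comm
  have hb := hy.mul_comm
  have x1 : x = a * (x * x) := by rw [← mul_assoc, ha, hx.2.1]
  have x2 : x = x * x * a := by rw [mul_assoc, ← ha, ← mul_assoc, hx.2.1]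
  have y1 : y = b * (y * y) := by rw [← mul_assoc, hb, hy.2.1]
  have y2 : y = y * y * b := by rw [mul_assoc, ← hb, ← mul_assoc, hy.2.1]
  have xb : x * b = 0 := by rw [x2, mul_assoc, hab, mul_zero]
  have bx : b * x = 0 := by rw [x1, ← mul_assoc, hba, zero_mul]
  have ay : a * y = 0 := by rw [y1, ← mul_assoc, hab, zero_mul]
  have ya : y * a = 0 := by rw [y2, mul_assoc, hba, mul_zero]
  have s1 : (a + b) * (x + y) = a * x + b * y := by
    rw [add_mul, mul_add, mul_add, ay, bx, add_zero, zero_add]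
  have s2 : (x + y) * (a + b) = x * a + y * b := by
    rw [add_mul, mul_add, mul_add, ya, xb, add_zero, zero_add]
  refine ⟨mem_centralizer_singleton_of_comm ?_, ?_, ?_⟩
  · rw [s1, s2, ha, hb]
  · rw [s2, add_mul, mul_add, mul_add, hx.2.1, hy.2.1, mul_assoc x, ay, mul_assoc y b x, bx,
      mul_zero, mul_zero, add_zero, zero_add]
  · have s3 : a + b - (a + b) ^ 2 * (x + y) = (a - a ^ 2 * x) + (b - b ^ 2 * y) := by
      have : (a + b) ^ 2 * (x + y) = a ^ 2 * x + b ^ 2 * y := by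
        rw [pow_two, mul_assoc, s1, add_mul, mul_add, mul_add, ← mul_assoc a b, hab,
          ← mul_assoc b a, hba, zero_mul, zero_mul, pow_two, pow_two, mul_assoc, mul_assoc]
        abel
      rw [this]
      abel
    rw [s3]
    have eb : b - b ^ 2 * y = b * (1 - b * y) := by noncomm_ring
    have ea : a - a ^ 2 * x = a * (1 - a * x) := by noncomm_ring
    have eb' : b - b ^ 2 * y = (1 - b * y) * b := by
      linear_combination (norm := noncomm_ring) -b * hb
    have ea' : a - a ^ 2 * x = (1 - a * x) * a := by
      linear_combination (norm := noncomm_ring) -a * ha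
    refine hx.2.2.add hy.2.2 ?_ ?_
    · rw [ea', eb, mul_assoc, ← mul_assoc a, hab, zero_mul, mul_zero]
    · rw [eb', ea, mul_assoc, ← mul_assoc b, hba, zero_mul, mul_zero]

/-- `0` is not an accumulation point of the spectrum of a generalized Drazin invertible element. -/
theorem IsGDrazinInvertible.eventually_isUnit {u : A} (h : IsGDrazinInvertible u) :
    ∀ᶠ z : ℂ in 𝓝[≠] 0, IsUnit (u - algebraMap ℂ A z) := by
  obtain ⟨y, hy⟩ := h
  have hev : ∀ᶠ z : ℂ in 𝓝 0, IsUnit (1 - algebraMap ℂ A z * y) := by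
    have hc : Continuous fun z : ℂ => 1 - algebraMap ℂ A z * y := by fun_prop
    refine hc.tendsto 0 (Units.isOpen.mem_nhds ?_)
    simp
  filter_upwards [hev.filter_mono nhdsWithin_le_nhds, self_mem_nhdsWithin] with z h1 hz
  have hz : z ≠ 0 := hz
  have h2 := isQuasinilpotent_iff.mp hy.2.2 z hz
  have huy := hy.mul_comm
  have hyuy := hy.2.1
  have he := one_sub_mul_self_of_outer_inverse hyuy
  have cu := Algebra.commutes z u
  have cy := Algebra.commutes z y
  generalize algebraMap ℂ A z = c at *
  have hu2 : Commute u (1 - u * y) :=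
    (Commute.one_right u).sub_right ((Commute.refl u).mul_right huy)
  have hy2 : Commute y (1 - u * y) :=
    (Commute.one_right y).sub_right (Commute.mul_right huy.symm (Commute.refl y))
  have hc2 : Commute c (1 - u * y) :=
    (Commute.one_right c).sub_right (Commute.mul_right cu cy)
  have hn : Commute (u - u ^ 2 * y - c) (1 - u * y) :=
    (hu2.sub_left ((hu2.pow_left 2).mul_left hy2)).sub_left hc2
  have hm : Commute (1 - c * y) (1 - u * y) :=
    (Commute.one_left _).sub_left (hc2.mul_left hy2)
  have key := isUnit_mul_add_mul_one_sub he h2 h1 hn hm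
  -- The factor `y + (1 - uy)` inverts `u` on the block `uy`, turning `u - c` into `1 - cy` there;
  -- on the block `1 - uy` it is the identity.
  have e : (u - u ^ 2 * y - c) * (1 - u * y) + (1 - c * y) * (1 - (1 - u * y))
      = (u - c) * (y + (1 - u * y)) := by
    linear_combination (norm := noncomm_ring) u ^ 2 * hyuy - c * hyuy
  have hcomm : Commute (u - c) (y + (1 - u * y)) :=
    (Commute.add_right huy hu2).sub_left (Commute.add_right cy hc2)
  rw [e] at key
  exact (hcomm.isUnit_mul_iff.mp key).1

end AgDrazin

/-! ### Moving spectral points and the double commutant -/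

namespace AgDrazin

variable {A : Type*} [NormedRing A] [NormedAlgebra ℂ A] [CompleteSpace A] [Nontrivial A]

/-- A nonzero complex number `l` can be removed from the spectrum of an element of `A^acc` by
splitting off the spectral idempotent of `l`. -/
theorem IsAcc.exists_remove_point {α : A} (hα : IsAcc α) {l : ℂ} (hl : l ≠ 0) :
    ∃ y : A, IsAgDrazinInverse α y ∧
      (∀ m : ℂ, m ≠ 0 → m = l ∨ IsUnit (α - algebraMap ℂ A m) →
        IsUnit (α - α ^ 2 * y - algebraMap ℂ A m)) ∧
      (∀ m : ℂ, m ≠ 0 → m ≠ l⁻¹ → IsUnit (y - algebraMap ℂ A m)) := by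
  obtain ⟨z, hz⟩ := hα l hl
  have hqn := isQuasinilpotent_iff.mp hz.2.2
  have hv := hqn (-l) (neg_ne_zero.mpr hl)
  rw [map_neg, sub_neg_eq_add] at hv
  have huz : Commute (α - algebraMap ℂ A l) z := hz.mul_comm
  have hzuz := hz.2.1
  have hLu : Commute (algebraMap ℂ A l) (α - algebraMap ℂ A l) := Algebra.commutes l _
  have hLz : Commute (algebraMap ℂ A l) z := Algebra.commutes l _
  have hα' : α = (α - algebraMap ℂ A l) + algebraMap ℂ A l := by abel
  obtain ⟨u, hu⟩ : ∃ u, u = α - algebraMap ℂ A l := ⟨_, rfl⟩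
  rw [← hu] at hz hqn hv huz hzuz hLu hα'
  have hαu : Commute α u := by rw [hα']; exact (Commute.refl u).add_left hLu
  have hαz : Commute α z := by rw [hα']; exact huz.add_left hLz
  -- `q` is the spectral idempotent of `α` at `l`. On its block `α` agrees with the unit `v = (u -
  -- u²z) + l`, so `v⁻¹q` is the required inverse.
  obtain ⟨q, hq⟩ : ∃ q, q = 1 - u * z := ⟨_, rfl⟩
  have hqq : q * q = q := by rw [hq]; exact one_sub_mul_self_of_outer_inverse hzuz
  have hcq : ∀ {c : A}, Commute c u → Commute c z → Commute c q := fun h1 h2 => by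
    rw [hq]; exact (Commute.one_right _).sub_right (h1.mul_right h2)
  have huq : Commute u q := hcq (Commute.refl u) huz
  have hzq : Commute z q := hcq huz.symm (Commute.refl z)
  have hαq : Commute α q := hcq hαu hαz
  have hMq : ∀ m : ℂ, Commute (algebraMap ℂ A m) q := fun m => Algebra.commutes m q
  have hnq : Commute (u - u ^ 2 * z) q := huq.sub_left ((huq.pow_left 2).mul_left hzq)
  have hαn : Commute α (u - u ^ 2 * z) := hαu.sub_right ((hαu.pow_right 2).mul_right hαz)
  obtain ⟨v, hv⟩ := hv
  have hαv : Commute α v := by rw [hv]; exact hαn.add_right (Algebra.commute_algebraMap_right l α)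
  have hvq : Commute (v : A) q := by rw [hv]; exact hnq.add_left (hMq l)
  have hαw : Commute α ↑v⁻¹ := hαv.units_inv_right
  have hwq : Commute (↑v⁻¹ : A) q := hvq.units_inv_left
  have e1 : α * q = v * q := by
    rw [hv, hq, hα']
    linear_combination (norm := noncomm_ring) -u ^ 2 * hzuz
  have e2 : α * (↑v⁻¹ * q) = q := by
    rw [← mul_assoc, hαw.eq, mul_assoc, e1, ← mul_assoc, v.inv_mul, one_mul]
  have e2' : ↑v⁻¹ * q * α = q := by rw [← (hαw.mul_right hαq).eq, e2]
  have e3 : α - α ^ 2 * (↑v⁻¹ * q) = α - α * q := by rw [pow_two, mul_assoc, e2]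
  have h1q : (1 - q) * (1 - q) = 1 - q := by
    linear_combination (norm := noncomm_ring) hqq
  have hc1q : ∀ {c : A}, Commute c q → Commute c (1 - q) := fun h =>
    (Commute.one_right _).sub_right h
  have e4 : ∀ m : ℂ, α - α * q - algebraMap ℂ A m
      = (α - algebraMap ℂ A m) * (1 - q) + (-algebraMap ℂ A m) * (1 - (1 - q)) := fun m => by
    noncomm_ring
  refine ⟨↑v⁻¹ * q, ⟨mem_centralizer_singleton_of_comm (by rw [e2, e2']), ?_, ?_⟩, ?_, ?_⟩
  · rw [e2', ← mul_assoc, ← hwq.eq, mul_assoc, hqq]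
  · rw [e3]
    intro m hm
    obtain ⟨y, hy⟩ := hα m hm
    rw [e4, ← map_neg, ← Algebra.smul_def]
    exact hy.corner h1q (hc1q (hαq.sub_left (hMq m))) (neg_ne_zero.mpr hm)
  · rw [e3]
    rintro m hm (rfl | h)
    -- On the block `1 - q` the remainder minus `m` is `u`, inverted by `z`; on the block `q` it is
    -- `-m`.
    · have e5 : (α - α * q - algebraMap ℂ A m) * (z + q)
          = 1 * (1 - q) + (-algebraMap ℂ A m) * (1 - (1 - q)) := by
        have hqz : q * z = 0 := by
          rw [hq, huz.eq]
          linear_combination (norm := noncomm_ring) -hzuz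
        have e6 : α - α * q - algebraMap ℂ A m = u * (1 - q) - algebraMap ℂ A m * q := by
          rw [hα']; noncomm_ring
        rw [e6]
        linear_combination (norm := noncomm_ring)
          -u * hqz - algebraMap ℂ A m * hqz - algebraMap ℂ A m * hqq - u * hqq + hq
      have h5 := isUnit_mul_add_mul_one_sub h1q isUnit_one (algebraMap_isUnit hm).neg
        (Commute.one_left _).eq (hc1q (hMq m).neg_left).eq
      rw [← e5] at h5
      have hMz : Commute (algebraMap ℂ A m) z := Algebra.commutes m z
      have hc : Commute (α - α * q - algebraMap ℂ A m) (z + q) :=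
        ((hαz.sub_left (hαz.mul_left hzq.symm)).sub_left hMz).add_right
          ((hαq.sub_left (hαq.mul_left (Commute.refl q))).sub_left (hMq m))
      exact (hc.isUnit_mul_iff.mp h5).1
    · rw [e4]
      exact isUnit_mul_add_mul_one_sub h1q h (algebraMap_isUnit hm).neg
        (hc1q (hαq.sub_left (hMq m))).eq (hc1q (hMq m).neg_left).eq
  · intro m hm hml
    have h6 := hqn (m⁻¹ - l) (sub_ne_zero.mpr fun h => hml (by rw [← h, inv_inv]))
    have h7 : (↑v⁻¹ : A) - algebraMap ℂ A m = -algebraMap ℂ A m * ↑v⁻¹ *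
        (u - u ^ 2 * z - algebraMap ℂ A (m⁻¹ - l)) := by
      have h8 : u - u ^ 2 * z - algebraMap ℂ A (m⁻¹ - l) = v - algebraMap ℂ A m⁻¹ := by
        rw [hv, map_sub]; abel
      have h9 : algebraMap ℂ A m * algebraMap ℂ A m⁻¹ = 1 := by
        rw [← map_mul, mul_inv_cancel₀ hm, map_one]
      rw [h8, mul_sub, mul_assoc, v.inv_mul, mul_assoc, ← Algebra.commutes m⁻¹, ← mul_assoc,
        neg_mul _ (algebraMap ℂ A m⁻¹), h9]
      noncomm_ring
    have h10 : IsUnit ((↑v⁻¹ : A) - algebraMap ℂ A m) := by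
      rw [h7]
      exact ((algebraMap_isUnit hm).neg.mul (v⁻¹).isUnit).mul h6
    have h11 : (↑v⁻¹ : A) * q - algebraMap ℂ A m
        = (↑v⁻¹ - algebraMap ℂ A m) * q + (-algebraMap ℂ A m) * (1 - q) := by noncomm_ring
    rw [h11]
    exact isUnit_mul_add_mul_one_sub hqq h10 (algebraMap_isUnit hm).neg
      (hwq.sub_left (hMq m)).eq (hMq m).neg_left.eq

/-- Finitely many nonzero points can be moved from the spectrum of `a - a² x` to the regular part
of an ag-Drazin decomposition. -/
theorem IsAgDrazinInverse.exists_remove_finset {a x : A} (hx : IsAgDrazinInverse a x) {δ : ℝ}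
    (hδ : 0 < δ) (hxδ : ∀ m : ℂ, δ⁻¹ < ‖m‖ → IsUnit (x - algebraMap ℂ A m)) (S : Finset ℂ)
    (hS : ∀ l ∈ S, δ ≤ ‖l‖) :
    ∃ x' : A, IsAgDrazinInverse a x' ∧
      (∀ m : ℂ, m ≠ 0 → m ∈ S ∨ IsUnit (a - a ^ 2 * x - algebraMap ℂ A m) →
        IsUnit (a - a ^ 2 * x' - algebraMap ℂ A m)) ∧
      (∀ m : ℂ, δ⁻¹ < ‖m‖ → IsUnit (x' - algebraMap ℂ A m)) := by
  classical
  induction S using Finset.induction_on with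
  | empty => exact ⟨x, hx, fun m _ h => by simpa using h, hxδ⟩
  | insert l S _ ih =>
    obtain ⟨w, hw, hw1, hw2⟩ := ih fun m hm => hS m (Finset.mem_insert_of_mem hm)
    have hl : δ ≤ ‖l‖ := hS l (Finset.mem_insert_self l S)
    have hl0 : l ≠ 0 := norm_pos_iff.mp (hδ.trans_le hl)
    obtain ⟨y, hy, hy1, hy2⟩ := hw.2.2.exists_remove_point hl0
    have haw := hw.mul_comm
    have hwaw := hw.2.1
    have hyα := hy.mul_comm
    have hyαy := hy.2.1
    -- The regular part `a²w` has zero remainder and is orthogonal to `a - a²w`, so the sum theorem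
    -- recombines the two.
    have hb : IsGDrazinInverse (a ^ 2 * w) w := by
      have h1 : a ^ 2 * w * w = a * w := by
        linear_combination (norm := noncomm_ring) a * haw * w + a * hwaw
      have h2 : w * (a ^ 2 * w) = a * w := by
        linear_combination (norm := noncomm_ring) -haw * (a * w) + a * hwaw
      refine ⟨mem_centralizer_singleton_of_comm (h1.trans h2.symm), ?_, ?_⟩
      · rw [h2, haw, hwaw]
      · have h3 : a ^ 2 * w - (a ^ 2 * w) ^ 2 * w = 0 := by
          rw [pow_two (a ^ 2 * w), mul_assoc (a ^ 2 * w), h1]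
          linear_combination (norm := noncomm_ring) -a ^ 2 * hwaw
        rw [h3]
        exact isQuasinilpotent_zero
    have hαw : (a - a ^ 2 * w) * w = 0 := by
      linear_combination (norm := noncomm_ring) -a * haw * w - a * hwaw
    have hwα : w * (a - a ^ 2 * w) = 0 := by
      linear_combination (norm := noncomm_ring) haw * (a * w) - haw - a * hwaw
    have hwa2 : a ^ 2 * w = w * a ^ 2 := by
      linear_combination (norm := noncomm_ring) a * haw + haw * a
    have hyw : y * w = 0 := by
      rw [← hyαy, mul_assoc y, hyα, ← mul_assoc, mul_assoc _ _ w, hαw, mul_zero]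
    have hαb : (a - a ^ 2 * w) * (a ^ 2 * w) = 0 := by
      calc _ = (a - a ^ 2 * w) * (w * a ^ 2) := by rw [← hwa2]
        _ = 0 := by rw [← mul_assoc, hαw, zero_mul]
    have hsum := hy.add hb hαb (by rw [mul_assoc, hwα, mul_zero])
    rw [sub_add_cancel] at hsum
    have hres : a - a ^ 2 * (y + w)
        = (a - a ^ 2 * w) - (a - a ^ 2 * w) ^ 2 * y := by
      have hwy : w * y = 0 := by
        rw [← hyαy, ← hyα, ← mul_assoc, ← mul_assoc, hwα, zero_mul, zero_mul]
      have : (a - a ^ 2 * w) ^ 2 * y = a ^ 2 * y := by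
        have h4 : a * w * a = a * a * w := by rw [mul_assoc, ← haw, mul_assoc]
        have h6 : (a - a ^ 2 * w) * y = a * y := by
          linear_combination (norm := noncomm_ring) -a ^ 2 * hwy
        rw [pow_two, mul_assoc, h6]
        linear_combination (norm := noncomm_ring) -a * h4 * y - a ^ 2 * a * hwy
      rw [this]
      noncomm_ring
    refine ⟨y + w, hsum, fun m hm h => ?_, fun m hm => ?_⟩
    · rw [hres]
      refine hy1 m hm ?_
      rcases h with h | h
      · rcases Finset.mem_insert.mp h with h | h
        · exact Or.inl h
        · exact Or.inr (hw1 m hm (Or.inl h))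
      · exact Or.inr (hw1 m hm (Or.inr h))
    · have hm0 : m ≠ 0 := norm_pos_iff.mp ((inv_pos.mpr hδ).trans hm)
      refine isUnit_add_sub_algebraMap hyw (hy2 m hm0 ?_) (hw2 m hm)
      rintro rfl
      rw [norm_inv] at hm
      exact absurd hm (not_lt.mpr (inv_anti₀ hδ hl))

/-- Outside a neighbourhood of `0`, an element of `A^acc` has only finitely many spectral values. -/
theorem IsAcc.finite_spectrum_inter {α : A} (hα : IsAcc α) {δ : ℝ} (hδ : 0 < δ) :
    (spectrum ℂ α ∩ {z | δ ≤ ‖z‖}).Finite := by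
  by_contra hinf
  have hK : IsCompact (spectrum ℂ α ∩ {z | δ ≤ ‖z‖}) :=
    (spectrum.isCompact α).inter_right (isClosed_le continuous_const continuous_norm)
  -- An infinite compact set has an accumulation point `l` in it; `l ≠ 0`, so `0` would be an
  -- accumulation point of `σ(α - l)`.
  obtain ⟨l, hlK, hl⟩ := Set.Infinite.exists_accPt_of_subset_isCompact hinf hK subset_rfl
  have hl0 : l ≠ 0 := norm_pos_iff.mp (hδ.trans_le hlK.2)
  have hev := (hα l hl0).eventually_isUnit
  have hfr := accPt_iff_frequently_nhdsNE.mp hl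
  have htend : Tendsto (fun z : ℂ => z - l) (𝓝[≠] l) (𝓝[≠] 0) := by
    refine tendsto_nhdsWithin_iff.mpr ⟨?_, ?_⟩
    · have : Tendsto (fun z : ℂ => z - l) (𝓝 l) (𝓝 (l - l)) := by
        exact (continuous_id.sub continuous_const).tendsto l
      rw [sub_self] at this
      exact this.mono_left nhdsWithin_le_nhds
    · filter_upwards [self_mem_nhdsWithin] with z hz
      exact sub_ne_zero.mpr hz
  obtain ⟨z, hz, hzu⟩ := (hfr.and_eventually (htend.eventually hev)).exists
  refine spectrum.mem_iff.mp hz.1 ?_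
  rw [IsUnit.sub_iff]
  have : α - algebraMap ℂ A z = α - algebraMap ℂ A l - algebraMap ℂ A (z - l) := by
    rw [map_sub]; abel
  rwa [this]

/-- An ag-Drazin invertible element has an ag-Drazin inverse in its double commutant. -/
theorem IsAgDrazinInvertible.exists_mem_centralizer_centralizer {a : A}
    (ha : IsAgDrazinInvertible a) :
    ∃ x ∈ Set.centralizer (Set.centralizer ({a} : Set A)), IsAgDrazinInverse a x := by
  obtain ⟨x, hx⟩ := ha
  obtain ⟨M, hM0, hM⟩ := (spectrum.isBounded (𝕜 := ℂ) x).exists_pos_norm_le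
  lift M to NNReal using hM0.le
  have hδ : 0 < (M : ℝ)⁻¹ := inv_pos.mpr hM0
  have hfin := hx.2.2.finite_spectrum_inter hδ
  have hxM : ∀ m : ℂ, (M : ℝ)⁻¹⁻¹ < ‖m‖ → IsUnit (x - algebraMap ℂ A m) := by
    intro m hm
    rw [inv_inv] at hm
    rw [IsUnit.sub_iff]
    by_contra hc
    exact absurd (hM m (spectrum.mem_iff.mpr hc)) (not_le.mpr hm)
  obtain ⟨y, hy, hy1, hy2⟩ := hx.exists_remove_finset hδ hxM hfin.toFinset
    fun l hl => (hfin.mem_toFinset.mp hl).2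
  refine ⟨y, ?_, hy⟩
  -- All points with `‖z‖ ≥ M⁻¹`, boundary included, were removed, so this bound is strict; that
  -- makes the product less than `1`.
  have hr1 : spectralRadius ℂ (a - a ^ 2 * y) < (M⁻¹ : NNReal) := by
    refine spectrum.spectralRadius_lt_of_forall_lt _ fun z hz => ?_
    rw [← NNReal.coe_lt_coe, NNReal.coe_inv]
    by_contra hc
    have hc' : (M : ℝ)⁻¹ ≤ ‖z‖ := not_lt.mp hc
    refine spectrum.mem_iff.mp hz (IsUnit.sub_iff.mp (hy1 z ?_ ?_))
    · exact norm_pos_iff.mp (hδ.trans_le hc')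
    · by_cases hz' : z ∈ spectrum ℂ (a - a ^ 2 * x)
      · exact Or.inl (hfin.mem_toFinset.mpr ⟨hz', hc'⟩)
      · exact Or.inr (IsUnit.sub_iff.mp (spectrum.notMem_iff.mp hz'))
  have hr2 : spectralRadius ℂ y ≤ M := by
    refine iSup₂_le fun z hz => ENNReal.coe_le_coe.mpr ?_
    rw [← NNReal.coe_le_coe]
    by_contra hc
    have hc' : M < ‖z‖ := not_le.mp hc
    exact spectrum.mem_iff.mp hz (IsUnit.sub_iff.mp (hy2 z (by rwa [inv_inv])))
  have hr : spectralRadius ℂ (a - a ^ 2 * y) * spectralRadius ℂ y < 1 := by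
    have hM1 : (M⁻¹ : NNReal) * M = 1 :=
      NNReal.eq (inv_mul_cancel₀ hM0.ne')
    calc _ ≤ spectralRadius ℂ (a - a ^ 2 * y) * (M : ENNReal) := by gcongr
      _ < ((M⁻¹ : NNReal) : ENNReal) * (M : ENNReal) := by
        refine (ENNReal.mul_lt_mul_iff_left ?_ ENNReal.coe_ne_top).mpr hr1
        exact ENNReal.coe_ne_zero.mpr fun h => hM0.ne' (congrArg NNReal.toReal h)
      _ = 1 := by rw [← ENNReal.coe_mul, hM1, ENNReal.coe_one]
  intro c hc
  exact (commute_of_spectralRadius_mul_lt_one hy.mul_comm hy.2.1 hr (hc a rfl)).symm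

end AgDrazin

theorem mainTheorem8 {A : Type*} [NormedRing A] [NormedAlgebra ℂ A] [CompleteSpace A]
    (a b : A) (ha : AgDrazin.IsAgDrazinInvertible a) (hb : AgDrazin.IsGDrazinInvertible b)
    (hab : a * b = 0) (hba : b * a = 0) :
    AgDrazin.IsAgDrazinInvertible (a + b) ∧
    (∃ x ∈ Set.centralizer (Set.centralizer ({a} : Set A)), AgDrazin.IsAgDrazinInverse a x) ∧
    (∀ x ∈ Set.centralizer (Set.centralizer ({a} : Set A)), AgDrazin.IsAgDrazinInverse a x →
      ∀ y : A, AgDrazin.IsGDrazinInverse b y →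
        AgDrazin.IsAgDrazinInverse (a + b) (x + y)) := by
  have : Nontrivial A := hb.choose_spec.nontrivial
  refine ⟨?_, ha.exists_mem_centralizer_centralizer, fun x _ hx y hy => hx.add hy hab hba⟩
  obtain ⟨x, hx⟩ := ha
  obtain ⟨y, hy⟩ := hb
  exact ⟨x + y, hx.add hy hab hba⟩
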